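/- **Setting.** A *state space model* (SSM) with input space $\Omega\subseteq\mathbb R^m$ and state space $\mathbb R^n$ is a family of affine vector fields $F_x(h)=A(x)h+b(x)$, $x\in\Omega$, where $A:\Omega\to\mathbb R^{n\times n}$ and $b:\Omega\to\mathbb R^n$ are real analytic (on a neighbourhood of each point of $\Omega$). Its *Lie algebra* $\mathfrak g$ is the smallest real Lie algebra of matrices, with the commutator bracket, that contains the homogenized generators $\begin{pmatrix}A(x)&b(x)\\0&0\end{pmatrix}$, $x\in\Omega$. (If $b=0$, this is $\mathrm{Lie}(\{A(x)\})$.) The SSM is then denoted $\mathbf S_{\mathfrak g}$. It is *abelian* if $\mathfrak g$ is abelian, i.e. if its vector fields $F_x$ commute. A *$k$-layer (cascade) SSM* with input space $\Omega$ is a system $$\dot h_i(t)=A_i(x_i(t))h_i(t)+b_i(x_i(t)),\quad x_0(t)=x(t),\quad x_i(t)=v_i(h_0(t),\dots,h_{i-1}(t),x(t))\ (1\le i\le k-1),$$ where layer $i$ is an SSM with state space $\mathcal M_i=\mathbb R^{n_i}$ and input space $\Omega_i$ (with $\Omega_0=\Omega$), and the maps $v_i:\mathcal M_0\times\cdots\times\mathcal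 M_{i-1}\times\Omega\to\Omega_i$ are smooth. It is *abelian* if every layer is abelian. Admissible inputs on $[0,T]$ are the integrable paths $x:[0,T]\to\Omega$ with values in a compact subset of $\Omega$ (if $\Omega=\mathbb R^m$: the bounded integrable paths); trajectories are solutions of the integral equation. An initialized system on $\mathcal M$ *simulates* an initialized system on $\mathcal M'$ with the same input space through $\varphi:\mathcal M\to\mathcal M'$ if $\varphi$ is a smooth surjective submersion and, for every $T\ge 0$ and every admissible input on $[0,T]$, the first system has a trajectory $p$ on $[0,T]$, and $\varphi(p(t))=h(t)$ for all $t\in[0,T]$, where $h$ is the trajectory of the second system. **Theorem.** Let $k\ge 1$ and let $\mathbf S_{\mathfrak g}$ be an SSM whose Lie algebra $\mathfrak g$ is solvable of derived length $k$. Then there are an abelian $k$-layer SSM and a smooth output map $\varphi$ from its total state space $\mathcal M_0\times\cdots\times\mathcal M_{k-1}$ to $\mathbb R^n$ such that, for every initial state $h_0\in\mathbb R^n$ of $\mathbf S_{\mathfrak g}$, there is an initial state of the $k$-layer SSM from which it simulates $\mathbf S_{\mathfrak g}$ initialized at $h_0$ through $\varphi$. -/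

import Mathlib

open scoped ContDiff

attribute [local instance 100] LieRing.ofAssociativeRing

noncomputable section

/-- A state space model with state space `ℝⁿ` and input space `Ω ⊆ ℝᵐ`: the family of affine
vector fields `F_x(h) = A(x) h + b(x)`, `x ∈ Ω`, with `A` and `b` real analytic on `Ω`
(analyticity of `A` is stated entry by entry). The values of `A` and `b` off `Ω` play no role.
The spaces `ℝᵐ`, `ℝⁿ` are `Fin m → ℝ`, `Fin n → ℝ`; nothing below depends on the choice
of a norm on them. -/
structure StateSpaceModel {m : ℕ} (Ω : Set (Fin m → ℝ)) (n : ℕ) where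
  /-- the (linear part of the) generator -/
  A : (Fin m → ℝ) → Matrix (Fin n) (Fin n) ℝ
  /-- the translation part -/
  b : (Fin m → ℝ) → (Fin n → ℝ)
  analytic_A : ∀ i j, AnalyticOnNhd ℝ (fun x => A x i j) Ω
  analytic_b : AnalyticOnNhd ℝ b Ω

namespace StateSpaceModel

variable {m : ℕ} {Ω : Set (Fin m → ℝ)} {n : ℕ}

/-- The controlled vector field `F_x(h) = A(x) h + b(x)`. -/
def field (S : StateSpaceModel Ω n) (x : Fin m → ℝ) (h : Fin n → ℝ) : Fin n → ℝ :=
  (S.A x).mulVec h + S.b x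

/-- The homogenized generator: the block matrix `[A(x), b(x); 0, 0]`, which acts on the
augmented state `(h, 1)`. -/
def homogenized (S : StateSpaceModel Ω n) (x : Fin m → ℝ) :
    Matrix (Fin n ⊕ Unit) (Fin n ⊕ Unit) ℝ :=
  Matrix.fromBlocks (S.A x) (Matrix.of fun i _ => S.b x i) 0 0

/-- The Lie algebra `𝔤` of the model: the smallest Lie algebra of matrices (with the commutator
bracket) that contains the homogenized generators `[A(x), b(x); 0, 0]`, `x ∈ Ω`.
It is the Lie algebra generated by the affine vector fields `F_x`, up to the usual sign of the
bracket. If `b = 0`, it is `Lie {A(x)}` (embedded as the upper left block). -/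
def lieAlgebra (S : StateSpaceModel Ω n) :
    LieSubalgebra ℝ (Matrix (Fin n ⊕ Unit) (Fin n ⊕ Unit) ℝ) :=
  LieSubalgebra.lieSpan ℝ (Matrix (Fin n ⊕ Unit) (Fin n ⊕ Unit) ℝ) (S.homogenized '' Ω)

/-- A model is abelian if its Lie algebra is: the affine vector fields `F_x` commute. -/
def IsAbelian (S : StateSpaceModel Ω n) : Prop :=
  IsLieAbelian S.lieAlgebra

end StateSpaceModel

/-- `DeepSSM Ω k M` is the type of deep state space models with `k` layers, external input
space `Ω` and total state space `M`, the product of the state spaces of the layers.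

* A single layer is a state space model driven by the external input `x`.
* Given a deep model with layers `0, …, k - 1` and total state `p = (h₀, …, h_{k-1})`, one more
  layer is a state space model `S` with some input space `Ω₁`, driven by `v(p, x) ∈ Ω₁`
  where `v` is smooth (at every point of `M × Ω`). -/
inductive DeepSSM {m : ℕ} (Ω : Set (Fin m → ℝ)) :
    ℕ → (M : Type) → [NormedAddCommGroup M] → [NormedSpace ℝ M] → Type 1
  | single {n : ℕ} (S : StateSpaceModel Ω n) : DeepSSM Ω 1 (Fin n → ℝ)
  | cascade {k : ℕ} {M : Type} [NormedAddCommGroup M] [NormedSpace ℝ M]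
      (D : DeepSSM Ω k M) {q n : ℕ} {Ω₁ : Set (Fin q → ℝ)} (S : StateSpaceModel Ω₁ n)
      (v : M × (Fin m → ℝ) → (Fin q → ℝ))
      (smooth_v : ∀ p : M, ∀ x ∈ Ω, ContDiffAt ℝ ∞ v (p, x))
      (maps_v : ∀ p : M, ∀ x ∈ Ω, v (p, x) ∈ Ω₁) :
      DeepSSM Ω (k + 1) (M × (Fin n → ℝ))

namespace DeepSSM

variable {m : ℕ} {Ω : Set (Fin m → ℝ)}

/-- The controlled vector field of a deep model on its total state space. -/
def field {k : ℕ} {M : Type} [NormedAddCommGroup M] [NormedSpace ℝ M] :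
    DeepSSM Ω k M → (Fin m → ℝ) → M → M
  | single S, x, h => S.field x h
  | cascade D S v _ _, x, p => (D.field x p.1, S.field (v (p.1, x)) p.2)

/-- A deep model is abelian if each of its layers is. -/
def IsAbelian {k : ℕ} {M : Type} [NormedAddCommGroup M] [NormedSpace ℝ M] :
    DeepSSM Ω k M → Prop
  | single S => S.IsAbelian
  | cascade D S _ _ _ => D.IsAbelian ∧ S.IsAbelian

end DeepSSM

/-- Admissible input paths on `[0, T]`: integrable, and bounded in the input space `Ω`, i.e. with
values in a compact subset of `Ω` (for `Ω = ℝᵐ` this is boundedness). -/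
def IsAdmissibleInput {m : ℕ} (Ω : Set (Fin m → ℝ)) (T : ℝ) (x : ℝ → (Fin m → ℝ)) : Prop :=
  MeasureTheory.IntegrableOn x (Set.Icc 0 T) ∧
    ∃ K : Set (Fin m → ℝ), K ⊆ Ω ∧ IsCompact K ∧ ∀ t ∈ Set.Icc 0 T, x t ∈ K

/-- `z` is the solution on `[0, T]` (in the sense of Carathéodory: the integral equation) of
`ż(t) = F(x(t), z(t))`, `z(0) = z₀`. -/
def IsTrajectory {m : ℕ} {M : Type} [NormedAddCommGroup M] [NormedSpace ℝ M]
    (F : (Fin m → ℝ) → M → M) (T : ℝ) (x : ℝ → (Fin m → ℝ)) (z₀ : M) (z : ℝ → M) : Prop :=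
  ContinuousOn z (Set.Icc 0 T) ∧
    ∀ t ∈ Set.Icc 0 T,
      IntervalIntegrable (fun s => F (x s) (z s)) MeasureTheory.volume 0 t ∧
        z t = z₀ + ∫ s in (0 : ℝ)..t, F (x s) (z s)

/-- The system `ṗ = F₀(x, p)` initialized at `p₀` simulates the system `ḣ = F₁(x, h)` initialized
at `h₀` (both with input space `Ω`) through the output map `φ`: the map `φ` is a smooth surjective
submersion and, for every admissible input on every interval `[0, T]`, the first system has a
trajectory on `[0, T]`, and `φ` maps it to the trajectory of the second system. -/
def SimulatesVia {m : ℕ} (Ω : Set (Fin m → ℝ))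
    {M₀ : Type} [NormedAddCommGroup M₀] [NormedSpace ℝ M₀]
    {M₁ : Type} [NormedAddCommGroup M₁] [NormedSpace ℝ M₁]
    (F₀ : (Fin m → ℝ) → M₀ → M₀) (p₀ : M₀)
    (F₁ : (Fin m → ℝ) → M₁ → M₁) (h₀ : M₁) (φ : M₀ → M₁) : Prop :=
  ContDiff ℝ ∞ φ ∧ Function.Surjective φ ∧
    (∀ p : M₀, Function.Surjective (fderiv ℝ φ p)) ∧
    ∀ (T : ℝ) (x : ℝ → (Fin m → ℝ)), 0 ≤ T → IsAdmissibleInput Ω T x →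
      (∃ p : ℝ → M₀, IsTrajectory F₀ T x p₀ p) ∧
      ∀ (p : ℝ → M₀) (h : ℝ → M₁), IsTrajectory F₀ T x p₀ p → IsTrajectory F₁ T x h₀ h →
        ∀ t ∈ Set.Icc 0 T, φ (p t) = h t

end

/-!
The proof is the method of Wei and Norman. In the augmented state `y = (h, 1)` the model is the
linear equation `ẏ = X(x) y` with `X(x)` in the Lie algebra `𝔤`. Let `𝔤 = V₀ ≥ V₁ ≥ ⋯ ≥ V_k = 0` be
the derived series, and let `e₁, …, e_d` be a basis of `Vᵢ`. Conjugation by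
`g(h) = exp (h₁ e₁) ⋯ exp (h_d e_d)` is trivial on `Vᵢ` modulo `Vᵢ₊₁` (`exp_conj_sub_mem`), and
`g⁻¹ dg ≡ ∑ dhᵢ eᵢ` modulo `Vᵢ₊₁`. Hence, if the variable `h` is driven by the coordinates
of a coefficient `a ∈ Vᵢ`, the substitution `z ↦ g(h)⁻¹ z` turns `ż = a z` into `ż = a' z` with
`a' ∈ Vᵢ₊₁` a smooth function of `h` and `a` (`exists_layerChart`). The equation
`ḣ = coordinates of a` is a layer of pure translations, which is abelian. After `k` such layers the
coefficient lies in `V_k = 0` (`exists_factorization`), so that the transformed state is constant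
and `y(t) = P(p(t)) y(0)`, where `p` is the total state and `P` is the product of the operators `g`.

The first layer has `n` additional variables with zero velocity, which store the initial state `h₀`.
The output map applies `P(p)` to the stored vector. It is affine and bijective in the stored
vector, hence a surjective submersion, and neither it nor the layers depend on `h₀`.

Inputs are merely integrable, so that the equations hold almost everywhere. As inputs take
values in a compact set, trajectories are Lipschitz; a Lipschitz function with derivative zero
almost everywhere is constant (`eq_initial_of_ae_hasDerivAt`).
-/

/-! ### Exponentials and conjugation -/

/-- The exponential series of an operator, applied to a vector. -/
theorem exp_apply_hasSum {F : Type*} [NormedAddCommGroup F] [NormedSpace ℝ F] [CompleteSpace F]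
    (L : F →L[ℝ] F) (x : F) :
    HasSum (fun i : ℕ => ((i.factorial : ℝ)⁻¹) • (L ^ i) x) (NormedSpace.exp L x) := by
  simpa using (NormedSpace.exp_series_hasSum_exp' (𝕂 := ℝ) L).mapL
    (ContinuousLinearMap.apply ℝ F x)

/-- If `L` sends `x` into an invariant closed subspace `W`, then `exp L x ≡ x` modulo `W`: every
term of the exponential series after the first lies in `W`. -/
theorem exp_apply_sub_mem {F : Type*} [NormedAddCommGroup F] [NormedSpace ℝ F] [CompleteSpace F]
    {L : F →L[ℝ] F} {W : Submodule ℝ F} (hW : IsClosed (W : Set F)) {x : F}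
    (hx : L x ∈ W) (hL : ∀ w ∈ W, L w ∈ W) : NormedSpace.exp L x - x ∈ W := by
  have hpow : ∀ i : ℕ, (L ^ (i + 1)) x ∈ W := by
    intro i
    induction i with
    | zero => simpa using hx
    | succ i ih => rw [pow_succ']; exact hL _ ih
  have hs := (hasSum_nat_add_iff' 1).2 (exp_apply_hasSum L x)
  simp only [Finset.range_one, Finset.sum_singleton, Nat.factorial_zero, Nat.cast_one, inv_one,
    pow_zero, one_smul, one_apply_eq_self] at hs
  exact hW.mem_of_tendsto hs
    (Filter.Eventually.of_forall fun s => W.sum_mem fun i _ => W.smul_mem _ (hpow i))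

section Algebra
variable {𝔸 : Type*} [NormedRing 𝔸] [NormedAlgebra ℝ 𝔸] [CompleteSpace 𝔸]

/-- The conjugation `a ↦ exp (-e) * a * exp e` is the exponential of `a ↦ a * e - e * a`, that is,
of `-ad e`. -/
theorem exp_neg_mul_mul_exp (e a : 𝔸) :
    NormedSpace.exp (-e) * a * NormedSpace.exp e =
      NormedSpace.exp
        ((ContinuousLinearMap.mul ℝ 𝔸).flip e + ContinuousLinearMap.mul ℝ 𝔸 (-e)) a := by
  have hpl : ∀ (u b : 𝔸) (i : ℕ), (ContinuousLinearMap.mul ℝ 𝔸 u ^ i) b = u ^ i * b := by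
    intro u b i
    induction i with
    | zero => simp
    | succ i ih => rw [pow_succ', mul_apply_eq_comp, ih, pow_succ']; simp [mul_assoc]
  have hpr : ∀ (u b : 𝔸) (i : ℕ), ((ContinuousLinearMap.mul ℝ 𝔸).flip u ^ i) b = b * u ^ i := by
    intro u b i
    induction i with
    | zero => simp
    | succ i ih => rw [pow_succ', mul_apply_eq_comp, ih, pow_succ]; simp [mul_assoc]
  have hl : ∀ u b : 𝔸,
      NormedSpace.exp (ContinuousLinearMap.mul ℝ 𝔸 u) b = NormedSpace.exp u * b := by
    intro u b
    refine (exp_apply_hasSum (ContinuousLinearMap.mul ℝ 𝔸 u) b).unique ?_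
    simpa [hpl] using (NormedSpace.exp_series_hasSum_exp' (𝕂 := ℝ) u).mul_right b
  have hr : ∀ u b : 𝔸,
      NormedSpace.exp ((ContinuousLinearMap.mul ℝ 𝔸).flip u) b = b * NormedSpace.exp u := by
    intro u b
    refine (exp_apply_hasSum ((ContinuousLinearMap.mul ℝ 𝔸).flip u) b).unique ?_
    simpa [hpr] using (NormedSpace.exp_series_hasSum_exp' (𝕂 := ℝ) u).mul_left b
  have hc : Commute ((ContinuousLinearMap.mul ℝ 𝔸).flip e) (ContinuousLinearMap.mul ℝ 𝔸 (-e)) := by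
    ext b
    simp [mul_assoc]
  let : NormedAlgebra ℚ (𝔸 →L[ℝ] 𝔸) := NormedAlgebra.restrictScalars ℚ ℝ _
  rw [NormedSpace.exp_add_of_commute hc, mul_apply_eq_comp, hl, hr]

/-- If all commutators of elements of `V` lie in `W ≤ V`, conjugation by `exp e`, `e ∈ V`, acts
trivially on `V` modulo `W`. -/
theorem exp_conj_sub_mem {V W : Submodule ℝ 𝔸} (hW : IsClosed (W : Set 𝔸)) (hWV : W ≤ V)
    (hVW : ∀ a ∈ V, ∀ b ∈ V, a * b - b * a ∈ W) {e a : 𝔸} (he : e ∈ V) (ha : a ∈ V) :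
    NormedSpace.exp (-e) * a * NormedSpace.exp e - a ∈ W := by
  rw [exp_neg_mul_mul_exp]
  refine exp_apply_sub_mem hW ?_ fun w hw => ?_
  · simpa [sub_eq_add_neg] using hVW a ha e he
  · simpa [sub_eq_add_neg] using hVW w (hWV hw) e he

theorem contDiff_exp_smul {G : Type*} [NormedAddCommGroup G] [NormedSpace ℝ G]
    (l : G →L[ℝ] ℝ) (e : 𝔸) : ContDiff ℝ ∞ fun h => NormedSpace.exp (l h • e) := by
  have h1 : ContDiff ℝ ∞ (NormedSpace.exp : 𝔸 → 𝔸) :=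
    contDiff_iff_contDiffAt.2 fun x => (NormedSpace.exp_analytic (𝕂 := ℝ) x).contDiffAt
  exact h1.comp (l.contDiff.smul contDiff_const)

theorem exp_mul_exp_neg (a : 𝔸) : NormedSpace.exp a * NormedSpace.exp (-a) = 1 := by
  let : NormedAlgebra ℚ 𝔸 := NormedAlgebra.restrictScalars ℚ ℝ _
  rw [← NormedSpace.exp_add_of_commute (Commute.neg_right (Commute.refl a)), add_neg_cancel,
    NormedSpace.exp_zero]

theorem exp_neg_mul_exp (a : 𝔸) : NormedSpace.exp (-a) * NormedSpace.exp a = 1 := by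
  simpa using exp_mul_exp_neg (-a)

theorem fderiv_exp_smul {G : Type*} [NormedAddCommGroup G] [NormedSpace ℝ G]
    (l : G →L[ℝ] ℝ) (e : 𝔸) (h v : G) :
    fderiv ℝ (fun h => NormedSpace.exp (l h • e)) h v
      = l v • (e * NormedSpace.exp (l h • e)) := by
  have := (hasDerivAt_exp_smul_const' (𝕂 := ℝ) e (l h)).hasFDerivAt.comp h l.hasFDerivAt
  have h2 := this.fderiv
  simp only [Function.comp_def] at h2
  rw [h2]; simp

end Algebra

/-! ### Charts of invertible operators -/

section Chart
variable {E : Type*} [NormedAddCommGroup E] [NormedSpace ℝ E] [CompleteSpace E]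

theorem map_exp_apply_eq {π : E →L[ℝ] ℝ} {a : E →L[ℝ] E} (h : ∀ v, π (a v) = 0) (v : E) :
    π (NormedSpace.exp a v) = π v := by
  have := exp_apply_sub_mem (L := a) (W := LinearMap.ker (π : E →ₗ[ℝ] ℝ)) π.isClosed_ker (x := v)
    (by simpa using h v) (fun w _ => by simpa using h w)
  simpa [sub_eq_zero] using this

/-- A smooth family `g h`, `h ∈ ℝᵈ`, of invertible operators with inverses `gInv h`, which preserve
the functional `π`, act trivially on `V` modulo `W` by conjugation, and move, modulo `W`, in the
prescribed directions `c v`: since `d(g⁻¹) g = - g⁻¹ dg`, the last field says that the left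
logarithmic derivative `g⁻¹ dg` in the direction `v` is `c v` modulo `W`. -/
structure GaugeChart (V W : Submodule ℝ (E →L[ℝ] E)) (π : E →L[ℝ] ℝ) {d : ℕ}
    (c : (Fin d → ℝ) → (E →L[ℝ] E)) where
  g : (Fin d → ℝ) → (E →L[ℝ] E)
  gInv : (Fin d → ℝ) → (E →L[ℝ] E)
  contDiff_g : ContDiff ℝ ∞ g
  contDiff_gInv : ContDiff ℝ ∞ gInv
  mul_inv : ∀ h, g h * gInv h = 1
  inv_mul : ∀ h, gInv h * g h = 1
  g_zero : g 0 = 1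
  map_g : ∀ h v, π (g h v) = π v
  conj_sub_mem : ∀ h, ∀ a ∈ V, gInv h * a * g h - a ∈ W
  fderiv_mul_add_mem : ∀ h v, fderiv ℝ gInv h v * g h + c v ∈ W

/-- The ordered product `exp (h₁ e₁) ⋯ exp (h_d e_d)` with `eᵢ ∈ V` is a gauge chart for
`v ↦ ∑ vᵢ eᵢ`. The factors are added one at a time on the right. -/
theorem nonempty_gaugeChart {V W : Submodule ℝ (E →L[ℝ] E)} {π : E →L[ℝ] ℝ}
    (hW : IsClosed (W : Set (E →L[ℝ] E))) (hWV : W ≤ V)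
    (hVW : ∀ a ∈ V, ∀ b ∈ V, a * b - b * a ∈ W) (hπ : ∀ a ∈ V, ∀ v, π (a v) = 0) :
    ∀ (d : ℕ) (e : Fin d → (E →L[ℝ] E)), (∀ i, e i ∈ V) →
      Nonempty (GaugeChart V W π fun v : Fin d → ℝ => ∑ i, v i • e i) := by
  intro d
  induction d with
  | zero =>
    intro e _
    exact ⟨{ g := fun _ => 1, gInv := fun _ => 1, contDiff_g := contDiff_const,
             contDiff_gInv := contDiff_const, mul_inv := by simp, inv_mul := by simp,
             g_zero := rfl, map_g := by simp, conj_sub_mem := by simp,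
             fderiv_mul_add_mem := by simp }⟩
  | succ d ih =>
    intro e he
    obtain ⟨C⟩ := ih (fun i => e i.castSucc) (fun i => he _)
    have heq : e (Fin.last d) ∈ V := he _
    let ini : (Fin (d + 1) → ℝ) →L[ℝ] (Fin d → ℝ) :=
      ContinuousLinearMap.pi fun i => ContinuousLinearMap.proj i.castSucc
    let l : (Fin (d + 1) → ℝ) →L[ℝ] ℝ := ContinuousLinearMap.proj (Fin.last d)
    set f := e (Fin.last d) with hf
    have hconj : ∀ (h : Fin (d + 1) → ℝ), ∀ a ∈ V,
        NormedSpace.exp (l h • -f) * a * NormedSpace.exp (l h • f) - a ∈ W := by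
      intro h a ha
      rw [smul_neg]
      exact exp_conj_sub_mem hW hWV hVW (V.smul_mem _ heq) ha
    have hconj' : ∀ (h : Fin (d + 1) → ℝ), ∀ a ∈ W,
        NormedSpace.exp (l h • -f) * a * NormedSpace.exp (l h • f) ∈ W := by
      intro h a ha
      simpa using W.add_mem (hconj h a (hWV ha)) ha
    have hinv : ∀ h, NormedSpace.exp (l h • f) * NormedSpace.exp (l h • -f) = 1 := fun h => by
      rw [smul_neg, exp_mul_exp_neg]
    have hinv' : ∀ h, NormedSpace.exp (l h • -f) * NormedSpace.exp (l h • f) = 1 := fun h => by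
      rw [smul_neg, exp_neg_mul_exp]
    have hgi : ContDiff ℝ ∞ fun h => C.gInv (ini h) := C.contDiff_gInv.comp ini.contDiff
    refine ⟨{ g := fun h => C.g (ini h) * NormedSpace.exp (l h • f)
              gInv := fun h => NormedSpace.exp (l h • -f) * C.gInv (ini h)
              contDiff_g := (C.contDiff_g.comp ini.contDiff).mul (contDiff_exp_smul l f)
              contDiff_gInv := (contDiff_exp_smul l (-f)).mul hgi
              mul_inv := fun h => ?_, inv_mul := fun h => ?_, g_zero := ?_, map_g := ?_
              conj_sub_mem := fun h a ha => ?_, fderiv_mul_add_mem := fun h v => ?_ }⟩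
    · rw [mul_assoc, ← mul_assoc _ _ (C.gInv _), hinv, one_mul, C.mul_inv]
    · rw [mul_assoc, ← mul_assoc _ (C.g _), C.inv_mul, one_mul, hinv']
    · simp [C.g_zero, NormedSpace.exp_zero]
    · intro h v
      rw [mul_apply_eq_comp, C.map_g, map_exp_apply_eq]
      intro w
      simp [hπ f heq]
    · have h1 := hconj' h _ (C.conj_sub_mem (ini h) a ha)
      have h2 := W.add_mem h1 (hconj h a ha)
      convert h2 using 1
      noncomm_ring
    · have hd : fderiv ℝ (fun h => NormedSpace.exp (l h • -f) * C.gInv (ini h)) h v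
          = NormedSpace.exp (l h • -f) * fderiv ℝ C.gInv (ini h) (ini v)
            + (l v • (-f * NormedSpace.exp (l h • -f))) * C.gInv (ini h) := by
        have h1 := ((contDiff_exp_smul l (-f)).differentiable (by simp) h).hasFDerivAt
        have h2 := ((C.contDiff_gInv.differentiable (by simp) (ini h)).hasFDerivAt).comp h
          ini.hasFDerivAt
        have h3 := (h1.mul' h2).fderiv
        have h4 : fderiv ℝ (fun h => NormedSpace.exp (l h • -f) * C.gInv (ini h)) h v = _ :=
          congrArg (fun T => T v) h3
        rw [h4, ← fderiv_exp_smul l (-f) h v]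
        simp
      rw [hd, Fin.sum_univ_castSucc]
      have h1 := hconj' h _ (C.fderiv_mul_add_mem (ini h) (ini v))
      have hS : (∑ i, ini v i • e i.castSucc) ∈ V :=
        V.sum_mem fun i _ => V.smul_mem _ (he _)
      have h2 := W.sub_mem h1 (hconj h _ hS)
      convert h2 using 1
      -- the factor `exp (h_d e_d)`, being the last one, contributes exactly `v_d e_d`
      have e1 : (l v • (-f * NormedSpace.exp (l h • -f))) * C.gInv (ini h) *
          (C.g (ini h) * NormedSpace.exp (l h • f)) = -(l v • f) := by
        rw [mul_assoc, ← mul_assoc _ (C.g _), C.inv_mul, one_mul, smul_mul_assoc, mul_assoc, hinv']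
        simp
      rw [add_mul, e1]
      have e2 : v (Fin.last d) • e (Fin.last d) = l v • f := rfl
      have e3 : (∑ i : Fin d, v i.castSucc • e i.castSucc) = ∑ i, ini v i • e i.castSucc := rfl
      rw [e2, e3]
      noncomm_ring

/-- The data by which one layer removes the part of a linear equation that lies in `V` modulo `W`.
The operators `g h` are invertible with inverse `gInv h`. If `Q` satisfies `Q̇ = a Q - Q X` with
`a ∈ V`, and the layer is driven by `ḣ = coord a`, then `g(h)⁻¹ Q` satisfies the same equation
with `residual h a ∈ W` in place of `a`. -/
structure LayerChart (V W : Submodule ℝ (E →L[ℝ] E)) (π : E →L[ℝ] ℝ) (d : ℕ) where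
  coord : (E →L[ℝ] E) →L[ℝ] (Fin d → ℝ)
  g : (Fin d → ℝ) → (E →L[ℝ] E)
  gInv : (Fin d → ℝ) → (E →L[ℝ] E)
  residual : (Fin d → ℝ) → (E →L[ℝ] E) → (E →L[ℝ] E)
  contDiff_g : ContDiff ℝ ∞ g
  contDiff_gInv : ContDiff ℝ ∞ gInv
  contDiff_residual : ContDiff ℝ ∞ fun q : (Fin d → ℝ) × (E →L[ℝ] E) => residual q.1 q.2
  mul_inv : ∀ h, g h * gInv h = 1
  inv_mul : ∀ h, gInv h * g h = 1
  g_zero : g 0 = 1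
  map_g : ∀ h v, π (g h v) = π v
  residual_mem : ∀ h, ∀ a ∈ V, residual h a ∈ W
  fderiv_gInv : ∀ h a, fderiv ℝ gInv h (coord a) = residual h a * gInv h - gInv h * a

/-- Layer charts exist: take the ordered product of exponentials along a basis of `V`, and as
`coord` the coordinates in that basis, extended linearly to all operators. -/
theorem exists_layerChart [FiniteDimensional ℝ E] {V W : Submodule ℝ (E →L[ℝ] E)} {π : E →L[ℝ] ℝ}
    (hWV : W ≤ V) (hVW : ∀ a ∈ V, ∀ b ∈ V, a * b - b * a ∈ W)
    (hπ : ∀ a ∈ V, ∀ v, π (a v) = 0) : ∃ d, Nonempty (LayerChart V W π d) := by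
  let B := Module.finBasis ℝ V
  obtain ⟨l, hl⟩ := V.subtype.exists_leftInverse_of_injective (Submodule.ker_subtype V)
  obtain ⟨C⟩ := nonempty_gaugeChart W.closed_of_finiteDimensional hWV hVW hπ _
    (fun i => (B i : E →L[ℝ] E)) (fun i => (B i).2)
  let c : (E →L[ℝ] E) →L[ℝ] (Fin (Module.finrank ℝ V) → ℝ) :=
    LinearMap.toContinuousLinearMap (B.equivFun.toLinearMap ∘ₗ l)
  have hc : ∀ a ∈ V, ∑ i, c a i • (B i : E →L[ℝ] E) = a := by
    intro a ha
    have h1 : l a = ⟨a, ha⟩ := LinearMap.congr_fun hl ⟨a, ha⟩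
    have h2 := congrArg V.subtype (B.sum_equivFun ⟨a, ha⟩)
    rw [map_sum] at h2
    simpa only [c, LinearMap.coe_toContinuousLinearMap', LinearMap.comp_apply, h1,
      LinearEquiv.coe_coe, map_smul, Submodule.subtype_apply] using h2
  refine ⟨_, ⟨{
    coord := c, g := C.g, gInv := C.gInv
    -- the value that the gauge transformation `Q ↦ g(h)⁻¹ Q` forces upon `residual`
    residual := fun h a => (fderiv ℝ C.gInv h (c a) + C.gInv h * a) * C.g h
    contDiff_g := C.contDiff_g, contDiff_gInv := C.contDiff_gInv
    contDiff_residual := ?_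
    mul_inv := C.mul_inv, inv_mul := C.inv_mul, g_zero := C.g_zero, map_g := C.map_g
    residual_mem := fun h a ha => ?_
    fderiv_gInv := fun h a => ?_ }⟩⟩
  · have h1 : ContDiff ℝ ∞ (fderiv ℝ C.gInv) := C.contDiff_gInv.fderiv_right (by simp)
    exact (((h1.comp contDiff_fst).clm_apply (c.contDiff.comp contDiff_snd)).add
      ((C.contDiff_gInv.comp contDiff_fst).mul contDiff_snd)).mul (C.contDiff_g.comp contDiff_fst)
  · have h1 := W.add_mem (C.fderiv_mul_add_mem h (c a)) (C.conj_sub_mem h a ha)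
    simp only [hc a ha] at h1
    convert h1 using 1
    noncomm_ring
  · rw [mul_assoc, C.mul_inv, mul_one, add_sub_cancel_right]
end Chart

/-! ### Trajectories -/

section Traj
open MeasureTheory Set

variable {m : ℕ} {Ω : Set (Fin m → ℝ)} {M : Type} [NormedAddCommGroup M]

/-- Along a continuous state path and an admissible input, a continuous map is bounded: both paths
stay in compact sets. -/
theorem exists_bound_along {F : Type*} [NormedAddCommGroup F] {w : M × (Fin m → ℝ) → F}
    (hw : ∀ p : M, ∀ x ∈ Ω, ContinuousAt w (p, x)) {T : ℝ}
    {p : ℝ → M} (hp : ContinuousOn p (Icc 0 T)) {x : ℝ → Fin m → ℝ}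
    (hx : IsAdmissibleInput Ω T x) : ∃ C, ∀ t ∈ Icc 0 T, ‖w (p t, x t)‖ ≤ C := by
  obtain ⟨-, K, hKΩ, hK, hxK⟩ := hx
  have hc : IsCompact ((p '' Icc 0 T) ×ˢ K) := (isCompact_Icc.image_of_continuousOn hp).prod hK
  obtain ⟨C, hC⟩ := hc.exists_bound_of_continuousOn (f := w)
    fun q hq => (hw q.1 q.2 (hKΩ hq.2)).continuousWithinAt
  exact ⟨C, fun t ht => hC _ ⟨mem_image_of_mem p ht, hxK t ht⟩⟩

variable [NormedSpace ℝ M]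

theorem integrableOn_along [FiniteDimensional ℝ M] {F : Type*} [NormedAddCommGroup F]
    [NormedSpace ℝ F] [FiniteDimensional ℝ F] {w : M × (Fin m → ℝ) → F}
    (hw : ∀ p : M, ∀ x ∈ Ω, ContinuousAt w (p, x)) {T : ℝ}
    {p : ℝ → M} (hp : ContinuousOn p (Icc 0 T)) {x : ℝ → Fin m → ℝ}
    (hx : IsAdmissibleInput Ω T x) : IntegrableOn (fun t => w (p t, x t)) (Icc 0 T) := by
  obtain ⟨C, hC⟩ := exists_bound_along hw hp hx
  obtain ⟨hxi, K, hKΩ, hK, hxK⟩ := hx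
  borelize M
  borelize F
  have := FiniteDimensional.proper_real M
  have := FiniteDimensional.proper_real F
  have hc : IsCompact ((p '' Icc 0 T) ×ˢ K) := (isCompact_Icc.image_of_continuousOn hp).prod hK
  -- `w` is continuous only on a part of the space; cutting it off makes it measurable everywhere
  have hm : Measurable (((p '' Icc 0 T) ×ˢ K).indicator w) := by
    classical
    rw [← piecewise_eq_indicator]
    exact ContinuousOn.measurable_piecewise
      (fun q hq => (hw q.1 q.2 (hKΩ hq.2)).continuousWithinAt) continuousOn_const
      hc.measurableSet
  have hpx : AEMeasurable (fun t => (p t, x t)) (volume.restrict (Icc 0 T)) :=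
    (hp.aemeasurable measurableSet_Icc).prodMk hxi.aestronglyMeasurable.aemeasurable
  have hmeas : AEStronglyMeasurable (fun t => w (p t, x t)) (volume.restrict (Icc 0 T)) := by
    refine (hm.comp_aemeasurable hpx).aestronglyMeasurable.congr ?_
    filter_upwards [ae_restrict_mem measurableSet_Icc] with t ht
    have hmem : (p t, x t) ∈ (p '' Icc 0 T) ×ˢ K := ⟨mem_image_of_mem p ht, hxK t ht⟩
    exact indicator_of_mem hmem w
  refine IntegrableOn.of_bound (by simp) hmeas C ?_
  filter_upwards [ae_restrict_mem measurableSet_Icc] with t ht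
  exact hC t ht

/-- A trajectory with bounded velocity is Lipschitz. -/
theorem IsTrajectory.lipschitzOnWith {F : (Fin m → ℝ) → M → M} {T : ℝ}
    {x : ℝ → Fin m → ℝ} {z₀ : M} {z : ℝ → M} (hz : IsTrajectory F T x z₀ z) {C : ℝ}
    (hC : ∀ t ∈ Icc 0 T, ‖F (x t) (z t)‖ ≤ C) :
    LipschitzOnWith (Real.toNNReal C) z (Icc 0 T) := by
  refine LipschitzOnWith.of_dist_le' fun t ht s hs => ?_
  rw [dist_eq_norm, Real.dist_eq, (hz.2 t ht).2, (hz.2 s hs).2, add_sub_add_left_eq_sub,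
    intervalIntegral.integral_interval_sub_left (hz.2 t ht).1 (hz.2 s hs).1]
  refine intervalIntegral.norm_integral_le_of_norm_le_const fun r hr => hC r ?_
  have : uIcc s t ⊆ Icc 0 T := ordConnected_Icc.uIcc_subset hs ht
  exact this (uIoc_subset_uIcc hr)

/-- A trajectory satisfies the differential equation almost everywhere, by the Lebesgue
differentiation theorem. -/
theorem IsTrajectory.ae_hasDerivAt [CompleteSpace M] {F : (Fin m → ℝ) → M → M} {T : ℝ}
    (hT : 0 ≤ T) {x : ℝ → Fin m → ℝ} {z₀ : M} {z : ℝ → M} (hz : IsTrajectory F T x z₀ z) :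
    ∀ᵐ t, t ∈ Icc 0 T → HasDerivAt z (F (x t) (z t)) t := by
  have h0 : ∀ᵐ t : ℝ, t ≠ 0 := by simp [ae_iff, measure_singleton]
  have h1 : ∀ᵐ t : ℝ, t ≠ T := by simp [ae_iff, measure_singleton]
  have hi := (hz.2 T (right_mem_Icc.2 hT)).1.ae_hasDerivAt_integral
  filter_upwards [h0, h1, hi] with t ht0 htT ht hmem
  rw [uIcc_of_le hT] at ht
  have hd := (ht hmem 0 (left_mem_Icc.2 hT)).const_add z₀
  refine hd.congr_of_eventuallyEq ?_
  have : Ioo 0 T ∈ nhds t :=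
    Ioo_mem_nhds (lt_of_le_of_ne hmem.1 ht0.symm) (lt_of_le_of_ne hmem.2 htT)
  filter_upwards [this] with s hs
  exact (hz.2 s (Ioo_subset_Icc_self hs)).2

/-- A `C¹` function whose derivative along a Lipschitz path vanishes is constant on that path: the
composition is Lipschitz, hence absolutely continuous, with derivative zero almost everywhere. -/
theorem eq_initial_of_ae_hasDerivAt {Z G : Type*} [NormedAddCommGroup Z] [NormedSpace ℝ Z]
    [FiniteDimensional ℝ Z] [NormedAddCommGroup G] [NormedSpace ℝ G] {T : ℝ} (hT : 0 ≤ T)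
    {z : ℝ → Z} {C : NNReal} (hz : LipschitzOnWith C z (Icc 0 T)) {z' : ℝ → Z}
    (hd : ∀ᵐ t, t ∈ Icc 0 T → HasDerivAt z (z' t) t) {ψ : Z → G} (hψ : ContDiff ℝ 1 ψ)
    (h0 : ∀ t ∈ Icc 0 T, fderiv ℝ ψ (z t) (z' t) = 0) :
    ∀ t ∈ Icc 0 T, ψ (z t) = ψ (z 0) := by
  have := FiniteDimensional.proper_real Z
  obtain ⟨r, hr⟩ :=
    (isCompact_Icc.image_of_continuousOn hz.continuousOn).isBounded.subset_closedBall (0 : Z)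
  obtain ⟨K, hK⟩ := (hψ.contDiffOn (s := Metric.closedBall 0 r)).exists_lipschitzOnWith (by simp)
    (convex_closedBall 0 r) (isCompact_closedBall 0 r)
  have hl : LipschitzOnWith (K * C) (ψ ∘ z) (uIcc 0 T) := by
    rw [uIcc_of_le hT]
    exact hK.comp hz fun t ht => hr (mem_image_of_mem z ht)
  obtain ⟨c, hc⟩ := hl.absolutelyContinuousOnInterval.const_of_ae_hasDerivAt_zero (by
    filter_upwards [hd] with t ht hmem
    rw [uIcc_of_le hT] at hmem
    have := ((hψ.differentiable one_ne_zero) (z t)).hasFDerivAt.comp_hasDerivAt t (ht hmem)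
    rwa [h0 t hmem] at this)
  rw [uIcc_of_le hT] at hc
  intro t ht
  exact (hc t ht).trans (hc 0 (left_mem_Icc.2 hT)).symm

theorem continuousOn_integral_and_intervalIntegrable {N : Type} [NormedAddCommGroup N]
    [NormedSpace ℝ N] {f : ℝ → N} {T : ℝ} (hf : IntegrableOn f (Icc 0 T)) (z₀ : N) :
    ContinuousOn (fun t => z₀ + ∫ s in (0 : ℝ)..t, f s) (Icc 0 T) ∧
      ∀ t ∈ Icc 0 T, IntervalIntegrable f volume 0 t := by
  have hi : ∀ t ∈ Icc 0 T, IntervalIntegrable f volume 0 t := fun t ht =>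
    (hf.mono_set (by rw [uIcc_of_le ht.1]; exact Icc_subset_Icc_right ht.2)).intervalIntegrable
  refine ⟨?_, hi⟩
  rcases le_or_gt 0 T with hT | hT
  · rw [← uIcc_of_le hT] at hf ⊢
    exact continuousOn_const.add (intervalIntegral.continuousOn_primitive_interval hf)
  · simp [Icc_eq_empty_of_lt hT]

end Traj

noncomputable section

/-! ### Translation layers -/

namespace StateSpaceModel
variable {q n : ℕ} {Ω : Set (Fin q → ℝ)}

/-- The model `ḣ = b(x)`, whose vector fields are translations and therefore commute. -/
def translation (b : (Fin q → ℝ) → (Fin n → ℝ)) (hb : AnalyticOnNhd ℝ b Ω) :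
    StateSpaceModel Ω n where
  A := 0
  b := b
  analytic_A _ _ := analyticOnNhd_const
  analytic_b := hb

@[simp]
theorem field_translation (b : (Fin q → ℝ) → (Fin n → ℝ)) (hb : AnalyticOnNhd ℝ b Ω)
    (x : Fin q → ℝ) (h : Fin n → ℝ) : (translation b hb).field x h = b x := by
  simp [field, translation]

theorem isAbelian_translation (b : (Fin q → ℝ) → (Fin n → ℝ)) (hb : AnalyticOnNhd ℝ b Ω) :
    (translation b hb).IsAbelian := by
  unfold IsAbelian lieAlgebra
  rw [LieSubalgebra.isLieAbelian_lieSpan_iff]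
  rintro _ ⟨x, -, rfl⟩ _ ⟨y, -, rfl⟩
  rw [LieRing.of_associative_ring_bracket]
  simp [homogenized, translation, Matrix.fromBlocks_multiply]

end StateSpaceModel

/-! ### Removing the derived series layer by layer -/

section Cascade
open MeasureTheory Set

variable {m : ℕ} {Ω : Set (Fin m → ℝ)}

/-- A deep model is tame if it is abelian, its field is smooth at every point of `M × Ω`, and every
admissible input has a trajectory from every initial state. -/
structure DeepSSM.IsTame {k : ℕ} {M : Type} [NormedAddCommGroup M] [NormedSpace ℝ M]
    (D : DeepSSM Ω k M) : Prop where
  isAbelian : D.IsAbelian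
  contDiffAt_field : ∀ p : M, ∀ x ∈ Ω,
    ContDiffAt ℝ ∞ (fun q : M × (Fin m → ℝ) => D.field q.2 q.1) (p, x)
  exists_trajectory : ∀ (T : ℝ) (x : ℝ → Fin m → ℝ) (p₀ : M), 0 ≤ T → IsAdmissibleInput Ω T x →
    ∃ p, IsTrajectory D.field T x p₀ p

theorem DeepSSM.isTame_single {n : ℕ} {b : (Fin m → ℝ) → (Fin n → ℝ)}
    (hb : AnalyticOnNhd ℝ b Ω) : (single (StateSpaceModel.translation b hb)).IsTame where
  isAbelian := StateSpaceModel.isAbelian_translation b hb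
  contDiffAt_field p x hx := by
    simp only [field, StateSpaceModel.field_translation]
    exact (hb x hx).contDiffAt.comp (p, x) contDiffAt_snd
  exists_trajectory T x p₀ hT hx := by
    -- the integrand does not depend on a state, so any constant state path will do
    have hi : IntegrableOn (fun t => b (x t)) (Icc 0 T) :=
      integrableOn_along (M := ℝ) (w := fun q => b q.2) (p := fun _ => 0)
        (fun p y hy => (hb y hy).continuousAt.comp (x := (p, y)) continuousAt_snd)
        continuousOn_const hx
    obtain ⟨h1, h2⟩ := continuousOn_integral_and_intervalIntegrable hi p₀
    refine ⟨_, h1, fun t ht => ?_⟩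
    simp only [field, StateSpaceModel.field_translation]
    exact ⟨h2 t ht, trivial⟩

theorem DeepSSM.IsTame.cascade {k : ℕ} {M : Type} [NormedAddCommGroup M] [NormedSpace ℝ M]
    [FiniteDimensional ℝ M] {D : DeepSSM Ω k M} (hD : D.IsTame) {d : ℕ}
    (v : M × (Fin m → ℝ) → (Fin d → ℝ))
    (hv : ∀ p : M, ∀ x ∈ Ω, ContDiffAt ℝ ∞ v (p, x)) :
    (DeepSSM.cascade D (Ω₁ := univ) (StateSpaceModel.translation id analyticOnNhd_id) v hv
      fun _ _ _ => mem_univ _).IsTame where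
  isAbelian := ⟨hD.isAbelian, StateSpaceModel.isAbelian_translation _ _⟩
  contDiffAt_field p x hx := by
    simp only [DeepSSM.field, StateSpaceModel.field_translation, id]
    have hf : ContDiffAt ℝ ∞ (fun q : (M × (Fin d → ℝ)) × (Fin m → ℝ) => (q.1.1, q.2)) (p, x) :=
      (contDiff_fst.fst.prodMk contDiff_snd).contDiffAt
    exact ContDiffAt.prodMk
      (ContDiffAt.comp (p, x) (g := fun q : M × (Fin m → ℝ) => D.field q.2 q.1)
        (hD.contDiffAt_field p.1 x hx) hf)
      (ContDiffAt.comp (p, x) (g := v) (hv p.1 x hx) hf)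
  exists_trajectory T x p₀ hT hx := by
    obtain ⟨p, hp⟩ := hD.exists_trajectory T x p₀.1 hT hx
    have hi : IntegrableOn (fun t => v (p t, x t)) (Icc 0 T) :=
      integrableOn_along (fun p y hy => (hv p y hy).continuousAt) hp.1 hx
    obtain ⟨h1, h2⟩ := continuousOn_integral_and_intervalIntegrable hi p₀.2
    refine ⟨_, hp.1.prodMk h1, fun t ht => ?_⟩
    simp only [DeepSSM.field, StateSpaceModel.field_translation, id]
    obtain ⟨h3, h4⟩ := hp.2 t ht
    have := FiniteDimensional.complete ℝ M
    constructor
    · rw [intervalIntegrable_iff] at h3 ⊢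
      exact Integrable.prodMk h3 ((intervalIntegrable_iff.1 (h2 t ht)))
    · have h5 : ∫ s in (0 : ℝ)..t, (D.field (x s) (p s), v (p s, x s)) =
          (∫ s in (0 : ℝ)..t, D.field (x s) (p s), ∫ s in (0 : ℝ)..t, v (p s, x s)) := by
        simp only [intervalIntegral.integral_of_le ht.1]
        exact integral_pair h3.1 (h2 t ht).1
      rw [h5, h4]
      rfl

variable {E : Type*} [NormedAddCommGroup E] [NormedSpace ℝ E]

/-- A deep model `D` that solves the linear equation `ẏ = X y` up to a remainder in `V`: along its
trajectories `Q` satisfies `Q̇ = R Q - Q X` with `R ∈ V`, where `Q p` is the inverse of `P p`. Thus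
`Q y` satisfies `(Q y)˙ = R (Q y)`, and it is constant if `V = 0`.

The total state also carries a constant vector of `ℝⁿ`, read off by `proj`; adding to it by `incl`
does not change `P`. The operators `P p` preserve the functional `π`. -/
structure Factorization (X : (Fin m → ℝ) → (E →L[ℝ] E)) (π : E →L[ℝ] ℝ) (n : ℕ)
    (V : Submodule ℝ (E →L[ℝ] E)) {k : ℕ} {M : Type} [NormedAddCommGroup M] [NormedSpace ℝ M]
    (D : DeepSSM Ω k M) where
  P : M → (E →L[ℝ] E)
  Q : M → (E →L[ℝ] E)
  R : M × (Fin m → ℝ) → (E →L[ℝ] E)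
  incl : (Fin n → ℝ) →L[ℝ] M
  proj : M →L[ℝ] (Fin n → ℝ)
  contDiff_P : ContDiff ℝ ∞ P
  contDiff_Q : ContDiff ℝ ∞ Q
  contDiffAt_R : ∀ p, ∀ x ∈ Ω, ContDiffAt ℝ ∞ R (p, x)
  mul_inv : ∀ p, P p * Q p = 1
  inv_mul : ∀ p, Q p * P p = 1
  P_zero : P 0 = 1
  map_P : ∀ p v, π (P p v) = π v
  R_mem : ∀ p, ∀ x ∈ Ω, R (p, x) ∈ V
  fderiv_Q : ∀ p, ∀ x ∈ Ω, fderiv ℝ Q p (D.field x p) = R (p, x) * Q p - Q p * X x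
  P_add_incl : ∀ p w, P (p + incl w) = P p
  proj_incl : ∀ w, proj (incl w) = w
  proj_field : ∀ p, ∀ x ∈ Ω, proj (D.field x p) = 0

variable {X : (Fin m → ℝ) → (E →L[ℝ] E)} {π : E →L[ℝ] ℝ} {n : ℕ}
  {V W : Submodule ℝ (E →L[ℝ] E)}

/-- The first layer. Its state space is `ℝᵈ × ℝⁿ`, where `ℝᵈ` is the domain of the chart and the
second factor is kept constant. -/
theorem LayerChart.exists_single [FiniteDimensional ℝ E] {d : ℕ} (C : LayerChart V W π d)
    (hX : AnalyticOnNhd ℝ X Ω) (hXV : ∀ x ∈ Ω, X x ∈ V) :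
    ∃ (M : Type) (_ : NormedAddCommGroup M) (_ : NormedSpace ℝ M) (D : DeepSSM Ω 1 M),
      FiniteDimensional ℝ M ∧ D.IsTame ∧ Nonempty (Factorization X π n W D) := by
  let Λ : (Fin (d + n) → ℝ) ≃L[ℝ] (Fin d → ℝ) × (Fin n → ℝ) :=
    ContinuousLinearEquiv.ofFinrankEq (by simp)
  let Λ₁ : (Fin (d + n) → ℝ) →L[ℝ] (Fin d → ℝ) × (Fin n → ℝ) := Λ
  let Λ₂ : (Fin d → ℝ) × (Fin n → ℝ) →L[ℝ] (Fin (d + n) → ℝ) := Λ.symm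
  let J : (E →L[ℝ] E) →L[ℝ] (Fin (d + n) → ℝ) :=
    Λ₂ ∘L ContinuousLinearMap.inl ℝ _ _ ∘L C.coord
  have hb : AnalyticOnNhd ℝ (fun x => J (X x)) Ω := J.comp_analyticOnNhd hX
  let a : (Fin (d + n) → ℝ) →L[ℝ] (Fin d → ℝ) :=
    ContinuousLinearMap.fst ℝ _ _ ∘L Λ₁
  have haJ : ∀ T, a (J T) = C.coord T := fun T => by simp [a, J, Λ₁, Λ₂]
  refine ⟨_, _, _, .single (StateSpaceModel.translation _ hb), inferInstance,
    DeepSSM.isTame_single hb, ⟨{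
      P := fun p => C.g (a p)
      Q := fun p => C.gInv (a p)
      R := fun q => C.residual (a q.1) (X q.2)
      incl := Λ₂ ∘L ContinuousLinearMap.inr ℝ _ _
      proj := ContinuousLinearMap.snd ℝ _ _ ∘L Λ₁
      contDiff_P := C.contDiff_g.comp a.contDiff
      contDiff_Q := C.contDiff_gInv.comp a.contDiff
      contDiffAt_R := fun p x hx => ?_
      mul_inv := fun p => C.mul_inv _
      inv_mul := fun p => C.inv_mul _
      P_zero := by simp [C.g_zero]
      map_P := fun p v => C.map_g _ _
      R_mem := fun p x hx => C.residual_mem _ _ (hXV x hx)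
      fderiv_Q := fun p x hx => ?_
      P_add_incl := fun p w => by simp [a, Λ₁, Λ₂]
      proj_incl := fun w => by simp [Λ₁, Λ₂]
      proj_field := fun p x hx => by simp [DeepSSM.field, J, Λ₁, Λ₂] }⟩⟩
  · have hXx : ContDiffAt ℝ ∞ (fun q : (Fin (d + n) → ℝ) × (Fin m → ℝ) => X q.2) (p, x) :=
      (hX x hx).contDiffAt.comp (p, x) contDiffAt_snd
    exact ContDiffAt.comp (p, x)
      (f := fun q : (Fin (d + n) → ℝ) × (Fin m → ℝ) => (a q.1, X q.2))
      C.contDiff_residual.contDiffAt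
      ((a.contDiff.comp contDiff_fst).contDiffAt.prodMk hXx)
  · have h1 := ((C.contDiff_gInv.differentiable (by simp) (a p)).hasFDerivAt.comp p
      a.hasFDerivAt).fderiv
    have h2 : fderiv ℝ (fun p => C.gInv (a p)) p (J (X x)) = _ :=
      congrArg (fun T => T (J (X x))) h1
    simp only [DeepSSM.field, StateSpaceModel.field_translation]
    rw [h2, ContinuousLinearMap.comp_apply, haJ, C.fderiv_gInv]

/-- One more layer, driven by the coordinates of the remainder of the previous ones, replaces
`P` by `P g(h)` and the remainder by `residual h R`. -/
theorem LayerChart.exists_cascade {d : ℕ} (C : LayerChart V W π d) {k : ℕ}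
    {M : Type} [NormedAddCommGroup M] [NormedSpace ℝ M] [FiniteDimensional ℝ M]
    {D : DeepSSM Ω k M} (hD : D.IsTame) (Φ : Factorization X π n V D) :
    ∃ (M' : Type) (_ : NormedAddCommGroup M') (_ : NormedSpace ℝ M') (D' : DeepSSM Ω (k + 1) M'),
      FiniteDimensional ℝ M' ∧ D'.IsTame ∧ Nonempty (Factorization X π n W D') := by
  have hv : ∀ p : M, ∀ x ∈ Ω, ContDiffAt ℝ ∞ (fun q => C.coord (Φ.R q)) (p, x) :=
    fun p x hx => C.coord.contDiff.contDiffAt.comp (p, x) (Φ.contDiffAt_R p x hx)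
  refine ⟨_, _, _, _, inferInstance, hD.cascade _ hv, ⟨{
      P := fun p => Φ.P p.1 * C.g p.2
      Q := fun p => C.gInv p.2 * Φ.Q p.1
      R := fun q => C.residual q.1.2 (Φ.R (q.1.1, q.2))
      incl := (ContinuousLinearMap.inl ℝ _ _) ∘L Φ.incl
      proj := Φ.proj ∘L ContinuousLinearMap.fst ℝ _ _
      contDiff_P := (Φ.contDiff_P.comp contDiff_fst).mul (C.contDiff_g.comp contDiff_snd)
      contDiff_Q := (C.contDiff_gInv.comp contDiff_snd).mul (Φ.contDiff_Q.comp contDiff_fst)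
      contDiffAt_R := fun p x hx => ?_
      mul_inv := fun p => ?_
      inv_mul := fun p => ?_
      P_zero := by simp [C.g_zero, Φ.P_zero]
      map_P := fun p v => by rw [mul_apply_eq_comp, Φ.map_P, C.map_g]
      R_mem := fun p x hx => C.residual_mem _ _ (Φ.R_mem _ x hx)
      fderiv_Q := fun p x hx => ?_
      P_add_incl := fun p w => by simp [Φ.P_add_incl]
      proj_incl := fun w => by simp [Φ.proj_incl]
      proj_field := fun p x hx => by simp [DeepSSM.field, Φ.proj_field p.1 x hx] }⟩⟩
  · have hR : ContDiffAt ℝ ∞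
        (fun q : (M × (Fin d → ℝ)) × (Fin m → ℝ) => Φ.R (q.1.1, q.2)) (p, x) :=
      ContDiffAt.comp (p, x) (g := Φ.R) (Φ.contDiffAt_R p.1 x hx)
        (contDiff_fst.fst.prodMk contDiff_snd).contDiffAt
    exact ContDiffAt.comp (p, x) (f := fun q : (M × (Fin d → ℝ)) × (Fin m → ℝ) =>
      (q.1.2, Φ.R (q.1.1, q.2))) C.contDiff_residual.contDiffAt
      (contDiff_fst.snd.contDiffAt.prodMk hR)
  · rw [mul_assoc, ← mul_assoc _ _ (Φ.Q _), C.mul_inv, one_mul, Φ.mul_inv]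
  · rw [mul_assoc, ← mul_assoc _ _ (C.g _), Φ.inv_mul, one_mul, C.inv_mul]
  · have h1 := (C.contDiff_gInv.differentiable (by simp) p.2).hasFDerivAt.comp p
      (hasFDerivAt_snd (𝕜 := ℝ))
    have h2 := (Φ.contDiff_Q.differentiable (by simp) p.1).hasFDerivAt.comp p
      (hasFDerivAt_fst (𝕜 := ℝ))
    have h3 : ∀ u, fderiv ℝ (fun p : M × (Fin d → ℝ) => C.gInv p.2 * Φ.Q p.1) p u = _ :=
      fun u => congrArg (fun T => T u) (h1.mul' h2).fderiv
    rw [h3]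
    simp only [DeepSSM.field, StateSpaceModel.field_translation, id]
    simp [Φ.fderiv_Q p.1 x hx, C.fderiv_gInv]
    noncomm_ring

/-- For a descending chain of subspaces `V i` such that the commutators of `V i` lie in `V (i + 1)`,
the linear equation `ẏ = X y` with `X ∈ V 0` is solved by `k + 1` layers up to a remainder in
`V (k + 1)`. -/
theorem exists_factorization [FiniteDimensional ℝ E] {V : ℕ → Submodule ℝ (E →L[ℝ] E)}
    (hV : Antitone V)
    (hVV : ∀ i, ∀ a ∈ V i, ∀ b ∈ V i, a * b - b * a ∈ V (i + 1))
    (hπ : ∀ a ∈ V 0, ∀ v, π (a v) = 0)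
    (hX : AnalyticOnNhd ℝ X Ω) (hXV : ∀ x ∈ Ω, X x ∈ V 0) (k : ℕ) :
    ∃ (M : Type) (_ : NormedAddCommGroup M) (_ : NormedSpace ℝ M) (D : DeepSSM Ω (k + 1) M),
      FiniteDimensional ℝ M ∧ D.IsTame ∧ Nonempty (Factorization X π n (V (k + 1)) D) := by
  have := FiniteDimensional.complete ℝ E
  have hC : ∀ i, ∃ d, Nonempty (LayerChart (V i) (V (i + 1)) π d) := fun i =>
    exists_layerChart (hV i.le_succ) (hVV i) fun a ha => hπ a (hV i.zero_le ha)
  induction k with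
  | zero =>
    obtain ⟨d, ⟨C⟩⟩ := hC 0
    exact C.exists_single hX hXV
  | succ k ih =>
    obtain ⟨M, _, _, D, _, hD, ⟨Φ⟩⟩ := ih
    obtain ⟨d, ⟨C⟩⟩ := hC (k + 1)
    exact C.exists_cascade hD Φ

end Cascade
end

noncomputable section

/-! ### The homogenized model -/

section Augmented

/-- The space of augmented states `(h, s)`, on which the homogenized generators act. The affine
state space is the hyperplane `s = 1`. -/
abbrev AugState (n : ℕ) : Type := Fin n ⊕ Unit → ℝ

/-- The algebra morphism that takes a matrix to the operator `v ↦ Z *ᵥ v` on augmented states. -/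
def matrixOperator (n : ℕ) :
    Matrix (Fin n ⊕ Unit) (Fin n ⊕ Unit) ℝ →ₐ[ℝ] (AugState n →L[ℝ] AugState n) :=
  (Module.End.toContinuousLinearMap (𝕜 := ℝ) (AugState n)).toAlgHom.comp
    Matrix.toLinAlgEquiv'.toAlgHom

variable {m n : ℕ} {Ω : Set (Fin m → ℝ)}

@[simp]
theorem matrixOperator_apply (Z : Matrix (Fin n ⊕ Unit) (Fin n ⊕ Unit) ℝ) (v : AugState n) :
    matrixOperator n Z v = Z.mulVec v := rfl

/-- The linear embedding `h ↦ (h, 0)`. -/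
def augIncl (n : ℕ) : (Fin n → ℝ) →L[ℝ] AugState n :=
  LinearMap.toContinuousLinearMap
    { toFun := fun h => Sum.elim h 0
      map_add' := fun h h' => by ext (i | i) <;> simp
      map_smul' := fun c h => by ext (i | i) <;> simp }

/-- The projection `(h, s) ↦ h`. -/
def augProj (n : ℕ) : AugState n →L[ℝ] (Fin n → ℝ) :=
  ContinuousLinearMap.pi fun i => ContinuousLinearMap.proj (Sum.inl i)

/-- The last coordinate `(h, s) ↦ s`. -/
def augLast (n : ℕ) : AugState n →L[ℝ] ℝ := ContinuousLinearMap.proj (Sum.inr ())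

/-- The augmented state `(0, 1)`; the state `h` is represented by `augIncl n h + augUnit n`. -/
def augUnit (n : ℕ) : AugState n := Sum.elim 0 1

@[simp]
theorem augProj_augIncl (h : Fin n → ℝ) : augProj n (augIncl n h) = h := rfl

@[simp]
theorem augProj_augUnit : augProj n (augUnit n) = 0 := rfl

@[simp]
theorem augLast_augIncl (h : Fin n → ℝ) : augLast n (augIncl n h) = 0 := rfl

theorem augIncl_augProj {v : AugState n} (hv : augLast n v = 0) :
    augIncl n (augProj n v) = v := by
  ext (i | i)
  · rfl
  · exact hv.symm

namespace StateSpaceModel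

/-- The homogenized generator as an operator on augmented states. -/
def generator (S : StateSpaceModel Ω n) (x : Fin m → ℝ) : AugState n →L[ℝ] AugState n :=
  matrixOperator n (S.homogenized x)

/-- On the hyperplane `s = 1` the homogenized generator is the affine field of the model. -/
theorem generator_apply (S : StateSpaceModel Ω n) (x : Fin m → ℝ) (h : Fin n → ℝ) :
    S.generator x (augIncl n h + augUnit n) = augIncl n (S.field x h) := by
  have h1 : augIncl n h + augUnit n = Sum.elim h 1 := by
    ext (i | i) <;> simp [augIncl, augUnit]
  rw [generator, matrixOperator_apply, h1, homogenized, Matrix.fromBlocks_mulVec]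
  ext (i | i) <;> simp [augIncl, field, Matrix.mulVec, dotProduct]

theorem analyticOnNhd_generator (S : StateSpaceModel Ω n) : AnalyticOnNhd ℝ S.generator Ω := by
  let L : (Fin n ⊕ Unit → Fin n ⊕ Unit → ℝ) →ₗ[ℝ] (AugState n →L[ℝ] AugState n) :=
    (matrixOperator n).toLinearMap ∘ₗ (Matrix.ofLinearEquiv ℝ).toLinearMap
  have h1 : AnalyticOnNhd ℝ (fun x i j => S.homogenized x i j) Ω := by
    refine AnalyticOnNhd.pi fun i => AnalyticOnNhd.pi fun j => ?_
    rcases i with i | i <;> rcases j with j | j <;>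
      simp only [homogenized, Matrix.fromBlocks_apply₁₁, Matrix.fromBlocks_apply₁₂,
        Matrix.fromBlocks_apply₂₁, Matrix.fromBlocks_apply₂₂, Matrix.of_apply, Matrix.zero_apply]
    · exact S.analytic_A i j
    · exact (ContinuousLinearMap.proj (R := ℝ) (φ := fun _ : Fin n => ℝ) i).comp_analyticOnNhd
        S.analytic_b
    · exact analyticOnNhd_const
    · exact analyticOnNhd_const
  exact (LinearMap.toContinuousLinearMap L).comp_analyticOnNhd h1

/-- The `i`-th term of the derived series of the Lie algebra of the model, as a space of
operators. -/
def derivedOperators (S : StateSpaceModel Ω n) (i : ℕ) :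
    Submodule ℝ (AugState n →L[ℝ] AugState n) :=
  (LieAlgebra.derivedSeries ℝ S.lieAlgebra i).toSubmodule.map
    ((matrixOperator n).toLinearMap ∘ₗ (S.lieAlgebra.incl : S.lieAlgebra →ₗ[ℝ] _))

theorem derivedOperators_antitone (S : StateSpaceModel Ω n) : Antitone S.derivedOperators :=
  fun _ _ h => Submodule.map_mono (LieAlgebra.derivedSeriesOfIdeal_antitone ⊤ h)

theorem commutator_mem_derivedOperators (S : StateSpaceModel Ω n) (i : ℕ)
    {a b : AugState n →L[ℝ] AugState n} (ha : a ∈ S.derivedOperators i)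
    (hb : b ∈ S.derivedOperators i) : a * b - b * a ∈ S.derivedOperators (i + 1) := by
  obtain ⟨Y, hY, rfl⟩ := ha
  obtain ⟨Z, hZ, rfl⟩ := hb
  refine ⟨⁅Y, Z⁆, ?_, ?_⟩
  · change ⁅Y, Z⁆ ∈ LieAlgebra.derivedSeries ℝ S.lieAlgebra (i + 1)
    rw [LieAlgebra.derivedSeries_def, LieAlgebra.derivedSeriesOfIdeal_succ]
    exact LieSubmodule.lie_mem_lie hY hZ
  · simp [LieRing.of_associative_ring_bracket]

theorem generator_mem_derivedOperators (S : StateSpaceModel Ω n) {x : Fin m → ℝ} (hx : x ∈ Ω) :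
    S.generator x ∈ S.derivedOperators 0 :=
  ⟨⟨S.homogenized x, LieSubalgebra.subset_lieSpan ⟨x, hx, rfl⟩⟩, LieSubmodule.mem_top _, rfl⟩

/-- All elements of the Lie algebra have zero last row, since the generators do and the matrices
with zero last row form a Lie algebra. -/
theorem augLast_derivedOperators (S : StateSpaceModel Ω n) {a : AugState n →L[ℝ] AugState n}
    (ha : a ∈ S.derivedOperators 0) (v : AugState n) : augLast n (a v) = 0 := by
  obtain ⟨⟨Z, hZ⟩, -, rfl⟩ := ha
  have key : ∀ j, Z (Sum.inr ()) j = 0 := by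
    refine LieSubalgebra.lieSpan_induction ℝ
      (p := fun Z _ => ∀ j, Z (Sum.inr ()) j = 0) ?_ ?_ ?_ ?_ ?_ hZ
    · rintro _ ⟨x, -, rfl⟩ (j | j) <;> rfl
    · exact fun _ => rfl
    · intro Y Z _ _ hY hZ j
      simp only [Matrix.add_apply, hY, hZ, add_zero]
    · intro c Y _ hY j
      simp only [Matrix.smul_apply, hY, smul_zero]
    · intro Y Z _ _ hY hZ j
      simp [LieRing.of_associative_ring_bracket, Matrix.mul_apply, hY, hZ]
  simp [augLast, Matrix.mulVec, dotProduct, key]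

theorem derivedOperators_eq_bot (S : StateSpaceModel Ω n)
    (hS : LieAlgebra.IsSolvable S.lieAlgebra) :
    S.derivedOperators (LieAlgebra.derivedLength ℝ S.lieAlgebra) = ⊥ := by
  obtain ⟨j, hj⟩ := (LieAlgebra.isSolvable_iff ℝ S.lieAlgebra).1 hS
  have h : LieAlgebra.derivedSeries ℝ S.lieAlgebra
      (LieAlgebra.derivedLength ℝ S.lieAlgebra) = ⊥ :=
    Nat.sInf_mem (s := {i | LieAlgebra.derivedSeriesOfIdeal ℝ S.lieAlgebra i ⊤ = ⊥}) ⟨j, hj⟩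
  rw [derivedOperators, h]
  simp

end StateSpaceModel
end Augmented

/-! ### The output map -/

section Simulation
open MeasureTheory Set

variable {m n k : ℕ} {Ω : Set (Fin m → ℝ)} {S : StateSpaceModel Ω n}
  {M : Type} [NormedAddCommGroup M] [NormedSpace ℝ M] {D : DeepSSM Ω k M}

namespace Factorization

/-- The output map `p ↦ P(p) · proj p`, where `P p` acts on states through the hyperplane
`s = 1`. -/
def output {V} (Φ : Factorization S.generator (augLast n) n V D) (p : M) : Fin n → ℝ :=
  augProj n (Φ.P p (augIncl n (Φ.proj p) + augUnit n))

theorem contDiff_output {V} (Φ : Factorization S.generator (augLast n) n V D) :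
    ContDiff ℝ ∞ Φ.output :=
  (augProj n).contDiff.comp (Φ.contDiff_P.clm_apply
    (((augIncl n).contDiff.comp Φ.proj.contDiff).add contDiff_const))

theorem output_add_incl {V} (Φ : Factorization S.generator (augLast n) n V D) (p : M)
    (w : Fin n → ℝ) :
    Φ.output (p + Φ.incl w) = Φ.output p + augProj n (Φ.P p (augIncl n w)) := by
  simp only [output, Φ.P_add_incl, map_add, Φ.proj_incl]
  abel

theorem surjective_output {V} (Φ : Factorization S.generator (augLast n) n V D) :
    Function.Surjective Φ.output := fun w =>
  ⟨0 + Φ.incl w, by rw [output_add_incl]; simp [output, Φ.P_zero]⟩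

/-- The output map is a submersion: in the direction of the constant part of the total state it is
affine, with linear part the restriction of `P p` to the hyperplane `s = 0`, which is invertible
because `P p` preserves the last coordinate. -/
theorem surjective_fderiv_output {V} (Φ : Factorization S.generator (augLast n) n V D) (p : M) :
    Function.Surjective (fderiv ℝ Φ.output p) := by
  intro w
  have h0 : augLast n (Φ.Q p (augIncl n w)) = 0 := by
    rw [← Φ.map_P p, ← mul_apply_eq_comp, Φ.mul_inv, one_apply_eq_self, augLast_augIncl]
  set u := augProj n (Φ.Q p (augIncl n w)) with hu
  have h1 : augProj n (Φ.P p (augIncl n u)) = w := by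
    rw [hu, augIncl_augProj h0, ← mul_apply_eq_comp, Φ.mul_inv, one_apply_eq_self, augProj_augIncl]
  refine ⟨Φ.incl u, ?_⟩
  rw [← (Φ.contDiff_output.differentiable (by simp) p).lineDeriv_eq_fderiv, lineDeriv]
  have h2 : (fun t : ℝ => Φ.output (p + t • Φ.incl u)) = fun t => Φ.output p + t • w := by
    ext1 t
    rw [← map_smul, output_add_incl, map_smul, map_smul, map_smul, h1]
  rw [h2]
  simpa using (((hasDerivAt_id (0 : ℝ)).smul_const w).const_add (Φ.output p)).deriv

/-- If no remainder is left, the output follows the model: along a pair of trajectories both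
`Q(p) · h` and `proj p` are constant, equal to the initial state. -/
theorem output_trajectory [FiniteDimensional ℝ M]
    (Φ : Factorization S.generator (augLast n) n ⊥ D) (hD : D.IsTame) {h₀ : Fin n → ℝ} {T : ℝ}
    (hT : 0 ≤ T) {x : ℝ → Fin m → ℝ} (hx : IsAdmissibleInput Ω T x) {p : ℝ → M}
    {h : ℝ → Fin n → ℝ} (hp : IsTrajectory D.field T x (Φ.incl h₀) p)
    (hh : IsTrajectory S.field T x h₀ h) : ∀ t ∈ Icc 0 T, Φ.output (p t) = h t := by
  have hcompl := FiniteDimensional.complete ℝ M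
  have hS : ∀ (h : Fin n → ℝ), ∀ x ∈ Ω,
      ContinuousAt (fun q : (Fin n → ℝ) × (Fin m → ℝ) => S.field q.2 q.1) (h, x) := by
    intro h x hx
    have h1 : (fun q : (Fin n → ℝ) × (Fin m → ℝ) => S.field q.2 q.1) =
        fun q => augProj n (S.generator q.2 (augIncl n q.1 + augUnit n)) := by
      simp [S.generator_apply]
    rw [h1]
    have h2 : ContinuousAt (fun q : (Fin n → ℝ) × (Fin m → ℝ) => S.generator q.2) (h, x) :=
      ContinuousAt.comp (x := (h, x)) (g := S.generator)
        (S.analyticOnNhd_generator x hx).continuousAt continuousAt_snd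
    exact (augProj n).continuous.continuousAt.comp (h2.clm_apply (by fun_prop))
  obtain ⟨C₁, hC₁⟩ := exists_bound_along (w := fun q : M × (Fin m → ℝ) => D.field q.2 q.1)
    (fun p x hx => (hD.contDiffAt_field p x hx).continuousAt) hp.1 hx
  obtain ⟨C₂, hC₂⟩ := exists_bound_along hS hh.1 hx
  have hxΩ : ∀ t ∈ Icc 0 T, x t ∈ Ω := by
    obtain ⟨-, K, hK, -, hxK⟩ := hx
    exact fun t ht => hK (hxK t ht)
  have hlip := (hp.lipschitzOnWith hC₁).prodMk (hh.lipschitzOnWith hC₂)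
  have hder : ∀ᵐ t, t ∈ Icc 0 T → HasDerivAt (fun t => (p t, h t))
      (D.field (x t) (p t), S.field (x t) (h t)) t := by
    filter_upwards [hp.ae_hasDerivAt hT, hh.ae_hasDerivAt hT] with t h1 h2 ht
    exact (h1 ht).prodMk (h2 ht)
  have hp0 : p 0 = Φ.incl h₀ := by simpa using (hp.2 0 (left_mem_Icc.2 hT)).2
  have hh0 : h 0 = h₀ := by simpa using (hh.2 0 (left_mem_Icc.2 hT)).2
  have hP0 : Φ.P (Φ.incl h₀) = 1 := by
    have := Φ.P_add_incl 0 h₀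
    rwa [zero_add, Φ.P_zero] at this
  have hQ0 : Φ.Q (Φ.incl h₀) = 1 := by
    have := Φ.inv_mul (Φ.incl h₀)
    rwa [hP0, mul_one] at this
  have hconst : ∀ t ∈ Icc 0 T,
      Φ.Q (p t) (augIncl n (h t) + augUnit n) = augIncl n h₀ + augUnit n := by
    have := eq_initial_of_ae_hasDerivAt hT hlip hder
      (ψ := fun z : M × (Fin n → ℝ) => Φ.Q z.1 (augIncl n z.2 + augUnit n))
      (((Φ.contDiff_Q.of_le (by simp)).comp contDiff_fst).clm_apply
        (((augIncl n).contDiff.comp contDiff_snd).add contDiff_const)) ?_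
    · simpa [hp0, hh0, hQ0] using this
    -- the derivative is `(R Q - Q X) y + Q X y` with `R = 0`
    · intro t ht
      have h1 := (Φ.contDiff_Q.differentiable (by simp) (p t)).hasFDerivAt.comp (p t, h t)
        (hasFDerivAt_fst (𝕜 := ℝ))
      have h2 := ((augIncl n).hasFDerivAt.comp (p t, h t)
        (hasFDerivAt_snd (𝕜 := ℝ))).add_const (augUnit n)
      have h3 := (h1.clm_apply h2).fderiv
      have h4 : ∀ u, fderiv ℝ (fun z : M × (Fin n → ℝ) =>
          Φ.Q z.1 (augIncl n z.2 + augUnit n)) (p t, h t) u = _ :=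
        fun u => congrArg (fun L => L u) h3
      rw [h4]
      have hR : Φ.R (p t, x t) = 0 := by simpa using Φ.R_mem (p t) (x t) (hxΩ t ht)
      simp only [add_apply, ContinuousLinearMap.comp_apply,
        ContinuousLinearMap.flip_apply, Function.comp_apply, ContinuousLinearMap.coe_fst',
        ContinuousLinearMap.coe_snd', Φ.fderiv_Q (p t) (x t) (hxΩ t ht), hR, zero_mul, zero_sub,
        neg_apply, mul_apply_eq_comp, S.generator_apply]
      simp
  have hproj : ∀ t ∈ Icc 0 T, Φ.proj (p t) = h₀ := by
    have := eq_initial_of_ae_hasDerivAt hT hlip hder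
      (ψ := (Φ.proj ∘L ContinuousLinearMap.fst ℝ M (Fin n → ℝ)))
      (ContinuousLinearMap.contDiff _) ?_
    · simpa [hp0, Φ.proj_incl] using this
    · intro t ht
      simpa using Φ.proj_field (p t) (x t) (hxΩ t ht)
  intro t ht
  rw [output, hproj t ht, ← hconst t ht, ← mul_apply_eq_comp, Φ.mul_inv, one_apply_eq_self]
  simp

end Factorization
end Simulation
end

theorem mainTheorem1 {m n k : ℕ} (Ω : Set (Fin m → ℝ)) (S : StateSpaceModel Ω n)
    (hsolv : LieAlgebra.IsSolvable S.lieAlgebra)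
    (hk : LieAlgebra.derivedLength ℝ S.lieAlgebra = k) (hk1 : 1 ≤ k) :
    ∃ (M : Type) (_ : NormedAddCommGroup M) (_ : NormedSpace ℝ M) (D : DeepSSM Ω k M)
      (φ : M → (Fin n → ℝ)),
      D.IsAbelian ∧
        ∀ h₀ : Fin n → ℝ, ∃ p₀ : M, SimulatesVia Ω D.field p₀ S.field h₀ φ := by
  obtain ⟨k, rfl⟩ := Nat.exists_eq_add_of_le' hk1
  have hbot : S.derivedOperators (k + 1) = ⊥ := hk ▸ S.derivedOperators_eq_bot hsolv
  obtain ⟨M, _, _, D, _, hD, ⟨Φ⟩⟩ := exists_factorization (n := n) S.derivedOperators_antitone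
    (fun i a ha b hb => S.commutator_mem_derivedOperators i ha hb)
    (fun a ha v => S.augLast_derivedOperators ha v) S.analyticOnNhd_generator
    (fun x hx => S.generator_mem_derivedOperators hx) k
  rw [hbot] at Φ
  exact ⟨M, _, _, D, Φ.output, hD.isAbelian, fun h₀ => ⟨Φ.incl h₀, Φ.contDiff_output,
    Φ.surjective_output, Φ.surjective_fderiv_output, fun T x hT hx =>
      ⟨hD.exists_trajectory T x _ hT hx, fun p h hp hh => Φ.output_trajectory hD hT hx hp hh⟩⟩⟩
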